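/- Let $G$ be a finite group and let $\hat G$ be the (finite) set of characters $\chi : G\to\mathbb C$ of irreducible finite dimensional $\mathbb C[G]$-modules. For a finite dimensional $\mathbb C[G]$-module $M$, let $\sigma(M)$ be the dimension over $\mathbb Q$ of its rational span, i.e. the least dimension $\dim_{\mathbb Q} M'$ of a finite dimensional $\mathbb Q[G]$-module $M'$ such that $M'\otimes_{\mathbb Q}\mathbb C$ contains a $\mathbb C[G]$-submodule isomorphic to $M$; for $M\neq 0$ put $\Phi(M)=\sigma(M)/\dim_{\mathbb C}M$. These numbers depend only on the character $\xi$ of $M$ and are also written $\sigma(\xi)$, $\Phi(\xi)$. For $\chi\in\hat G$, let $\mathbb Q(\chi)\subseteq\mathbb C$ be the field generated over $\mathbb Q$ by the values of $\chi$, and let the Schur index $m(\chi)$ be the least degree $[L:\mathbb Q(\chi)]$ of a finite extension $L$ of $\mathbb Q(\chi)$ in $\mathbb C$ over which a module $M$ with character $\chi$ can be realized (i.e. $M\cong \mathbb C\otimes_L W$ for some $L[G]$-module $W$). Let $\bar{\mathbb Q}$ be the algebraic closure of $\mathbb Q$ in $\mathbb C$. The group $\mathrm{Gal}(\bar{\mathbb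 Q}/\mathbb Q)$ acts on $\hat G$ by $(\gamma\chi)(g)=\gamma(\chi(g))$; let $orb(\hat G)$ be the set of its orbits. **Lemma 4.1.** (a) If $\chi\in\hat G$, then $\Phi(\chi)=m(\chi)\cdot[\mathbb Q(\chi):\mathbb Q]$. In particular, $\Phi(\chi)$ is an integer. (b) For every character $\xi=\sum_{\chi\in\hat G}n_\chi\,\chi$, with integers $n_\chi\ge 0$, $$\sigma(\xi)=\sum_{\Gamma\in orb(\hat G)}\ \max_{\chi\in\Gamma}\left(\left\lceil\frac{n_\chi}{m(\chi)}\right\rceil\sigma(\chi)\right).$$ -/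

import Mathlib

open scoped TensorProduct

namespace RatSpan

noncomputable section

/-- Extension of scalars `L ⊗[K] W` of a representation `W` of `G` over `K`. -/
def extendScalars {K : Type*} (L : Type*) [Field K] [Field L] [Algebra K L] {G : Type*} [Group G]
    {W : Type*} [AddCommGroup W] [Module K W] (τ : Representation K G W) :
    Representation L G (L ⊗[K] W) :=
  (Module.End.baseChangeHom K L W : Module.End K W →* Module.End L (L ⊗[K] W)).comp τ

section Modules

variable {G : Type*} [Group G] {V : Type*} [AddCommGroup V] [Module ℂ V]

/-- The dimensions of the finite dimensional `ℚ[G]`-modules `W` such that `ℂ ⊗ W` contains a copy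
of the `ℂ[G]`-module `V`. (Every finite dimensional rational vector space is isomorphic to one in
the lowest universe.) -/
def spanDims (ρ : Representation ℂ G V) : Set ℕ :=
  {d | ∃ (W : Type) (_ : AddCommGroup W) (_ : Module ℚ W) (_ : FiniteDimensional ℚ W)
      (τ : Representation ℚ G W) (f : Representation.IntertwiningMap ρ (extendScalars ℂ τ)),
      Function.Injective f ∧ Module.finrank ℚ W = d}

/-- `σ(V)`: the dimension over `ℚ` of the rational span of `V`, that is of a `ℚ[G]`-module `W` of
minimal dimension such that `ℂ ⊗ W` contains `V`. -/
def sigma (ρ : Representation ℂ G V) : ℕ := sInf (spanDims ρ)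

/-- `Φ(V) = σ(V) / dim V`. -/
def Phi (ρ : Representation ℂ G V) : ℚ := (sigma ρ : ℚ) / (Module.finrank ℂ V : ℚ)

/-- The character field `ℚ(χ) ⊆ ℂ`, generated by the values of `χ`. -/
def charField (χ : G → ℂ) : IntermediateField ℚ ℂ := IntermediateField.adjoin ℚ (Set.range χ)

/-- `V` can be realized over the field `L`, a field with a given embedding into `ℂ`: it is
isomorphic to `ℂ ⊗[L] W` for a finite dimensional `L[G]`-module `W`. -/
def RealizableOver (L : Type) [Field L] [Algebra L ℂ] (ρ : Representation ℂ G V) : Prop :=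
  ∃ (W : Type) (_ : AddCommGroup W) (_ : Module L W) (_ : FiniteDimensional L W)
    (τ : Representation L G W), Nonempty (Representation.Equiv (extendScalars ℂ τ) ρ)

/-- The Schur index of an (irreducible) `ℂ[G]`-module `V` with character `χ`: the least degree
`[L : ℚ(χ)]` of a finite extension `L` of `ℚ(χ)` (inside `ℂ`) over which `V` can be realized. -/
def schurIndex (ρ : Representation ℂ G V) : ℕ :=
  sInf {d | ∃ L : IntermediateField (charField ρ.character) ℂ,
    FiniteDimensional (charField ρ.character) L ∧ RealizableOver L ρ ∧
      Module.finrank (charField ρ.character) L = d}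

/-- The values of a character of a finite group are algebraic numbers. -/
theorem isAlgebraic_character [Finite G] [FiniteDimensional ℂ V] (ρ : Representation ℂ G V)
    (g : G) : IsAlgebraic ℚ (ρ.character g) := by
  have hs : (ρ g).charpoly.Splits := IsAlgClosed.splits _
  unfold Representation.character
  rw [Module.End.trace_eq_sum_roots_charpoly_of_splits hs, isAlgebraic_iff_isIntegral]
  refine IsIntegral.multiset_sum fun x hx => ?_
  have hx' : Module.End.HasEigenvalue (ρ g) x := by
    rw [Module.End.hasEigenvalue_iff_isRoot_charpoly]
    exact Polynomial.isRoot_of_mem_roots hx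
  obtain ⟨v, hv⟩ := hx'.exists_hasEigenvector
  have h1 := hv.pow_apply (orderOf g)
  rw [← map_pow, pow_orderOf_eq_one, map_one] at h1
  have h2 : x ^ orderOf g = 1 := by
    have : (x ^ orderOf g - 1) • v = 0 := by
      rw [sub_smul, ← h1]; simp
    rcases smul_eq_zero.1 this with h | h
    · exact sub_eq_zero.1 h
    · exact absurd h hv.2
  refine IsIntegral.of_pow (orderOf_pos g) ?_
  rw [h2]
  exact isIntegral_one

end Modules

/-- `Ĝ`: the characters of the irreducible finite dimensional `ℂ[G]`-modules (every finite
dimensional complex vector space being isomorphic to some `ℂⁿ`). -/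
def IrrChar (G : Type*) [Group G] : Type _ :=
  {χ : G → ℂ // ∃ (n : ℕ) (ρ : Representation ℂ G (Fin n → ℂ)),
    ρ.IsIrreducible ∧ ρ.character = χ}

namespace IrrChar

variable {G : Type*} [Group G]

/-- The dimension `χ(1)` of a module affording `χ`. -/
def deg (χ : IrrChar G) : ℕ := χ.2.choose

/-- A `ℂ[G]`-module affording the irreducible character `χ`; it is unique up to isomorphism. -/
def rep (χ : IrrChar G) : Representation ℂ G (Fin χ.deg → ℂ) := χ.2.choose_spec.choose

theorem rep_irreducible (χ : IrrChar G) : χ.rep.IsIrreducible :=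
  χ.2.choose_spec.choose_spec.1

theorem rep_character (χ : IrrChar G) : χ.rep.character = χ.1 :=
  χ.2.choose_spec.choose_spec.2

/-- `σ(χ)`, the dimension of the rational span of a module affording `χ`. -/
def sigma (χ : IrrChar G) : ℕ := RatSpan.sigma χ.rep

/-- `m(χ)`, the Schur index of `χ`. -/
def schurIndex (χ : IrrChar G) : ℕ := RatSpan.schurIndex χ.rep

/-- `Ĝ` is finite, because irreducible characters are linearly independent functions. -/
instance instFinite [Finite G] : Finite (IrrChar G) := by
  have := Fintype.ofFinite G
  have : LinearIndependent ℂ (fun χ : IrrChar G => χ.1) := by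
    rw [linearIndependent_iff']
    intro s c hc j hj
    have hN : (Nat.card G : ℂ) ≠ 0 := Nat.cast_ne_zero.2 Nat.card_pos.ne'
    have : Invertible (Nat.card G : ℂ) := invertibleOfNonzero hN
    classical
    have horth : ∀ i : IrrChar G, (Nat.card G : ℂ)⁻¹ * ∑ g : G, i.1 g * j.1 g⁻¹ =
        if i = j then 1 else 0 := by
      intro i
      have := i.rep_irreducible
      have := j.rep_irreducible
      rw [← i.rep_character, ← j.rep_character, Representation.char_orthonormal]
      refine if_congr ⟨?_, ?_⟩ rfl rfl
      · rintro ⟨e⟩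
        apply Subtype.ext
        rw [← i.rep_character, ← j.rep_character, Representation.char_iso e]
      · rintro rfl
        exact ⟨Representation.Equiv.refl _⟩
    have h0 : (Nat.card G : ℂ)⁻¹ * ∑ g : G, (∑ i ∈ s, c i • i.1) g * j.1 g⁻¹ = 0 := by
      rw [hc]; simp
    have h1 : (Nat.card G : ℂ)⁻¹ * ∑ g : G, (∑ i ∈ s, c i • i.1) g * j.1 g⁻¹ =
        ∑ i ∈ s, c i * ((Nat.card G : ℂ)⁻¹ * ∑ g : G, i.1 g * j.1 g⁻¹) := by
      simp only [Finset.sum_apply, Pi.smul_apply, smul_eq_mul, Finset.sum_mul, Finset.mul_sum]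
      rw [Finset.sum_comm]
      refine Finset.sum_congr rfl fun i _ => Finset.sum_congr rfl fun g _ => ?_
      ring
    rw [h1] at h0
    simp only [horth] at h0
    simpa [hj] using h0
  exact this.finite

instance instFintype [Finite G] : Fintype (IrrChar G) := Fintype.ofFinite _

variable [Finite G]

/-- The value `χ(g)` as an element of `ℚ̄`, the algebraic closure of `ℚ` in `ℂ`. -/
def algVal (χ : IrrChar G) (g : G) : algebraicClosure ℚ ℂ :=
  ⟨χ.1 g, by
    rw [mem_algebraicClosure_iff, ← χ.rep_character]
    exact isAlgebraic_character χ.rep g⟩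

/-- Two irreducible characters are Galois conjugate if `χ' = γ ∘ χ` for some
`γ ∈ Gal(ℚ̄/ℚ)`. -/
def galoisSetoid (G : Type*) [Group G] [Finite G] : Setoid (IrrChar G) where
  r χ χ' := ∃ γ : algebraicClosure ℚ ℂ ≃ₐ[ℚ] algebraicClosure ℚ ℂ,
    ∀ g, χ'.algVal g = γ (χ.algVal g)
  iseqv :=
    { refl := fun _ => ⟨AlgEquiv.refl, fun _ => rfl⟩
      symm := by
        rintro χ χ' ⟨γ, h⟩
        exact ⟨γ.symm, fun g => by rw [h, AlgEquiv.symm_apply_apply]⟩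
      trans := by
        rintro χ χ' χ'' ⟨γ, h⟩ ⟨δ, h'⟩
        exact ⟨γ.trans δ, fun g => by rw [h', h, AlgEquiv.trans_apply]⟩ }

end IrrChar

/-- `orb(Ĝ)`: the set of orbits of the absolute Galois group of `ℚ` on `Ĝ`. -/
def Orb (G : Type*) [Group G] [Finite G] : Type _ := Quotient (IrrChar.galoisSetoid G)

instance instFintypeOrb {G : Type*} [Group G] [Finite G] : Fintype (Orb G) :=
  have : Finite (Orb G) := inferInstanceAs (Finite (Quotient (IrrChar.galoisSetoid G)))
  Fintype.ofFinite _

open Classical in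
/-- An orbit `Γ`, as a (nonempty, finite) set of irreducible characters. -/
def Orb.chars {G : Type*} [Group G] [Finite G] (Γ : Orb G) : Finset (IrrChar G) :=
  Finset.univ.filter fun χ => Quotient.mk (IrrChar.galoisSetoid G) χ = Γ

theorem Orb.chars_nonempty {G : Type*} [Group G] [Finite G] (Γ : Orb G) : Γ.chars.Nonempty := by
  classical
  obtain ⟨χ, hχ⟩ := Quotient.exists_rep Γ
  exact ⟨χ, by rw [Orb.chars, Finset.mem_filter]; exact ⟨Finset.mem_univ _, hχ⟩⟩

end

end RatSpan

/-!
Write `K = ℚ(χ)`. The proof compares multiplicities: `IrrChar.mult χ τ` is the multiplicity of `χ`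
in the complexification of a rational representation `τ`, and characters compute it because the
dimension of a space of intertwining maps is a scalar product of characters. A complex module
embeds into another one exactly when no multiplicity decreases
(`exists_injective_of_finrank_hom_le`, `finrank_hom_le_of_injective`).

Let `W` be an irreducible `ℚ[G]`-module containing `χ`. A maximal commutative subalgebra `F` of its
endomorphism algebra is a field, and the only `F[G]`-endomorphisms of `W` are the elements of `F`
(`exists_field_end_eq_one`). Hence the `F`-valued character `ψ` of `W` has `⟨ψ, ψ⟩ = 1`, every
embedding `s : F → ℂ` makes `s ∘ ψ` an irreducible character, and the character of `W` over `ℚ`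
is the trace of `ψ`, the sum of the `s ∘ ψ`. One of these is `χ`; so `W` is the restriction to `ℚ`
of a realization of `χ` over a field `L = s(F)` containing `K` (`IrrChar.exists_realization`).
Conversely, restricting any realization of `χ` over a finite extension `L` of `K` gives a rational
module of dimension `[L : K] [K : ℚ] χ(1)` in which the conjugates of `χ` have multiplicity
`[L : K]` and no other character occurs (`IrrChar.finrank_hom_realization`), since an embedding of
`K` has `[L : K]` extensions to `L`.

Irreducible rational modules sharing a complex constituent are isomorphic
(`IrrChar.nonempty_equiv_of_mult`). Comparing `W` with the restriction of a realization of least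
degree shows that this least degree, the Schur index, is `[L : K]` for the field `L` above
(`IrrChar.mult_eq`), and that `W` is the rational span of `χ` (`IrrChar.sigma_eq`); this is the
formula for `Φ`. Irreducible rational modules thus correspond to Galois orbits, a rational module
is given by a number `k Γ` for each orbit `Γ`, and it contains a module with multiplicities `n χ`
exactly when `n χ ≤ k Γ * m(χ)` for all `χ ∈ Γ`. Minimizing `∑ k Γ * σ(Γ)` gives the formula for
`σ` of an arbitrary module.
-/

namespace RatSpan

open Representation Module

/-! ### Representations in characteristic zero -/

section General

variable {k G V W U : Type*} [Field k] [CharZero k] [Group G] [Finite G]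
  [AddCommGroup V] [Module k V] [AddCommGroup W] [Module k W] [AddCommGroup U] [Module k U]

theorem neZero_natCard : NeZero (Nat.card G : k) :=
  ⟨Nat.cast_ne_zero.2 Nat.card_pos.ne'⟩

/-- Maschke's theorem for intertwining maps: an injective one has a retraction. -/
theorem exists_leftInverse_of_injective {ρ : Representation k G V} {σ : Representation k G W}
    (f : IntertwiningMap ρ σ) (hf : Function.Injective f) :
    ∃ r : IntertwiningMap σ ρ, ∀ v, r (f v) = v := by
  have : NeZero (Nat.card G : k) := neZero_natCard
  obtain ⟨g, hg⟩ := MonoidAlgebra.exists_leftInverse_of_injective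
    (IntertwiningMap.equivLinearMapAsModule ρ σ f) (LinearMap.ker_eq_bot.2 hf)
  refine ⟨(IntertwiningMap.equivLinearMapAsModule σ ρ).symm g, fun v => ?_⟩
  exact congrArg (fun h => h v) hg

/-- The inclusion of a subrepresentation. -/
def inclusion {ρ : Representation k G V} (p : Subrepresentation ρ) :
    IntertwiningMap p.toRepresentation ρ where
  toLinearMap := p.toSubmodule.subtype
  isIntertwining' _ := rfl

omit [CharZero k] [Finite G] in
theorem inclusion_injective {ρ : Representation k G V} (p : Subrepresentation ρ) :
    Function.Injective (inclusion p) := p.toSubmodule.subtype_injective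

/-- The image of an injective intertwining map splits off as a direct factor. -/
theorem exists_equiv_prod {ρ : Representation k G V} {σ : Representation k G W}
    (f : IntertwiningMap ρ σ) (hf : Function.Injective f) :
    ∃ p : Subrepresentation σ, Nonempty (Equiv (ρ.prod p.toRepresentation) σ) := by
  obtain ⟨r, hr⟩ := exists_leftInverse_of_injective f hf
  refine ⟨r.ker, ⟨IntertwiningMap.ofBijective
    (f.comp (IntertwiningMap.fst k ρ _) + (inclusion r.ker).comp (IntertwiningMap.snd k ρ _))
    ⟨?_, ?_⟩⟩⟩
  · rw [injective_iff_map_eq_zero]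
    rintro ⟨a, b, hb⟩ h
    have h1 : f a + b = 0 := h
    have h2 : r b = 0 := hb
    have h3 : a = 0 := by
      have := congrArg r h1
      rwa [map_add, hr, h2, add_zero, map_zero] at this
    subst h3
    rw [map_zero, zero_add] at h1
    subst h1
    rfl
  · intro w
    refine ⟨(r w, ⟨w - f (r w), ?_⟩), ?_⟩
    · change r (w - f (r w)) = 0
      rw [map_sub, hr, sub_self]
    · change f (r w) + (w - f (r w)) = w
      abel

variable [FiniteDimensional k V] [FiniteDimensional k W] [FiniteDimensional k U]

omit [Finite G] [CharZero k] in
theorem char_prod (ρ : Representation k G V) (σ : Representation k G W) :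
    (ρ.prod σ).character = ρ.character + σ.character := by
  ext g
  exact LinearMap.trace_prodMap' (ρ g) (σ g)

/-- The dimension of the space of intertwining maps is the scalar product of the characters. -/
theorem finrank_hom_eq [Fintype G] (ρ : Representation k G V) (σ : Representation k G W) :
    (finrank k (IntertwiningMap ρ σ) : k) =
      (Nat.card G : k)⁻¹ * ∑ g : G, σ.character g * ρ.character g⁻¹ := by
  have : NeZero (Nat.card G : k) := neZero_natCard
  have : Invertible (Nat.card G : k) := invertibleOfNonzero (NeZero.ne _)
  exact (card_inv_mul_sum_char_mul_char_eq_finrank ρ σ).symm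

theorem finrank_hom_comm (ρ : Representation k G V) (σ : Representation k G W) :
    finrank k (IntertwiningMap ρ σ) = finrank k (IntertwiningMap σ ρ) := by
  have := Fintype.ofFinite G
  rw [← Nat.cast_inj (R := k), finrank_hom_eq, finrank_hom_eq]
  congr 1
  refine Fintype.sum_equiv (Equiv.inv G) _ _ fun g => ?_
  simp [mul_comm]

theorem finrank_hom_congr {ρ : Representation k G V} {σ : Representation k G W}
    {σ' : Representation k G U} (h : σ.character = σ'.character) :
    finrank k (IntertwiningMap ρ σ) = finrank k (IntertwiningMap ρ σ') := by
  have := Fintype.ofFinite G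
  rw [← Nat.cast_inj (R := k), finrank_hom_eq, finrank_hom_eq, h]

theorem finrank_hom_prod (ρ : Representation k G V) (σ : Representation k G W)
    (τ : Representation k G U) : finrank k (IntertwiningMap ρ (σ.prod τ)) =
      finrank k (IntertwiningMap ρ σ) + finrank k (IntertwiningMap ρ τ) := by
  have := Fintype.ofFinite G
  rw [← Nat.cast_inj (R := k), Nat.cast_add, finrank_hom_eq, finrank_hom_eq, finrank_hom_eq,
    char_prod]
  simp [add_mul, Finset.sum_add_distrib, mul_add]

omit [CharZero k] [Finite G] in
theorem finrank_hom_ne_zero {ρ : Representation k G V} {σ : Representation k G W} :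
    finrank k (IntertwiningMap ρ σ) ≠ 0 ↔ ∃ f : IntertwiningMap ρ σ, f ≠ 0 := by
  rw [← Nat.pos_iff_ne_zero, finrank_pos_iff_exists_ne_zero]

/-- A representation whose only endomorphisms are the scalars is irreducible. -/
theorem isIrreducible_of_finrank_end (ρ : Representation k G V)
    (h : finrank k (IntertwiningMap ρ ρ) = 1) : ρ.IsIrreducible := by
  -- The projection onto a subrepresentation is a scalar, so its image is zero or everything.
  have h1 : ∀ e : IntertwiningMap ρ ρ, ∃ c : k, c • (1 : IntertwiningMap ρ ρ) = e := by
    have : (1 : IntertwiningMap ρ ρ) ≠ 0 := by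
      intro h0
      obtain ⟨f, hf⟩ := finrank_hom_ne_zero.1 (h.trans_ne one_ne_zero)
      apply hf
      rw [← mul_one f, h0, mul_zero]
    exact (finrank_eq_one_iff_of_nonzero' _ this).1 h
  have hV : Nontrivial V := by
    by_contra hV
    rw [not_nontrivial_iff_subsingleton] at hV
    obtain ⟨f, hf⟩ := finrank_hom_ne_zero.1 (h.trans_ne one_ne_zero)
    exact hf (IntertwiningMap.ext (LinearMap.ext fun v => Subsingleton.elim _ _))
  have : Nontrivial (Subrepresentation ρ) := by
    refine ⟨⊥, ⊤, fun h => ?_⟩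
    have : (⊥ : Submodule k V) = ⊤ := congrArg Subrepresentation.toSubmodule h
    exact bot_ne_top this
  refine ⟨fun p => ?_⟩
  obtain ⟨r, hr⟩ := exists_leftInverse_of_injective _ (inclusion_injective p)
  obtain ⟨c, hc⟩ := h1 ((inclusion p).comp r)
  have hc' : ∀ v, c • v = (r v : V) := fun v => congrArg (fun e => e v) hc
  by_cases h0 : c = 0
  · left
    apply Subrepresentation.toSubmodule_injective
    refine (Submodule.eq_bot_iff _).2 fun v hv => ?_
    have h2 := hr ⟨v, hv⟩
    have h3 := hc' v
    rw [h0, zero_smul] at h3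
    have h4 : ((r v : p.toSubmodule) : V) = v := congrArg Subtype.val h2
    rw [← h4, ← h3]
  · right
    apply Subrepresentation.toSubmodule_injective
    refine (Submodule.eq_top_iff').2 fun v => ?_
    have h3 : c • v ∈ p.toSubmodule := by rw [hc' v]; exact (r v).2
    exact (Submodule.smul_mem_iff _ h0).1 h3

omit [FiniteDimensional k W] [Finite G] [CharZero k] in
/-- A nonzero representation contains an irreducible one. -/
theorem exists_irreducible_subrepresentation [Nontrivial V] (ρ : Representation k G V) :
    ∃ p : Subrepresentation ρ, p.toRepresentation.IsIrreducible := by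
  classical
  have hex : ∃ d, ∃ p : Subrepresentation ρ, p.toSubmodule ≠ ⊥ ∧ finrank k p.toSubmodule = d :=
    ⟨_, ⊤, fun h => bot_ne_top (α := Submodule k V) h.symm, rfl⟩
  -- A nonzero subrepresentation of least dimension is irreducible.
  obtain ⟨p, hp, hd⟩ := Nat.find_spec hex
  refine ⟨p, ?_⟩
  have : Nontrivial (Subrepresentation p.toRepresentation) := by
    refine ⟨⊥, ⊤, fun h => hp ?_⟩
    have h' : (⊥ : Submodule k p.toSubmodule) = ⊤ := congrArg Subrepresentation.toSubmodule h
    exact (Submodule.subsingleton_iff_eq_bot).1 (subsingleton_of_bot_eq_top h' |> fun h =>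
      (Submodule.subsingleton_iff k).1 h)
  refine ⟨fun q => ?_⟩
  by_cases hq : q.toSubmodule = ⊥
  · exact Or.inl (Subrepresentation.toSubmodule_injective hq)
  · right
    apply Subrepresentation.toSubmodule_injective
    apply Submodule.eq_top_of_finrank_eq
    refine le_antisymm (Submodule.finrank_le _) ?_
    rw [hd]
    refine Nat.find_min' hex ⟨⟨q.toSubmodule.map p.toSubmodule.subtype, ?_⟩, ?_, ?_⟩
    · rintro g _ ⟨v, hv, rfl⟩
      exact ⟨_, q.apply_mem_toSubmodule g hv, rfl⟩
    · intro h0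
      apply hq
      apply Submodule.map_injective_of_injective p.toSubmodule.subtype_injective
      exact h0.trans (Submodule.map_bot _).symm
    · exact (Submodule.equivMapOfInjective _ p.toSubmodule.subtype_injective _).finrank_eq.symm

/-- A nonzero representation splits off an irreducible factor. -/
theorem exists_irreducible_prod [Nontrivial V] (ρ : Representation k G V) :
    ∃ p q : Subrepresentation ρ, p.toRepresentation.IsIrreducible ∧
      Nonempty (Equiv (p.toRepresentation.prod q.toRepresentation) ρ) := by
  obtain ⟨p, hp⟩ := exists_irreducible_subrepresentation ρ
  obtain ⟨q, hq⟩ := exists_equiv_prod _ (inclusion_injective p)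
  exact ⟨p, q, hp, hq⟩

omit [CharZero k] [FiniteDimensional k V] [FiniteDimensional k W] [Finite G] in
theorem nontrivial_of_isIrreducible (ρ : Representation k G V) (h : ρ.IsIrreducible) :
    Nontrivial V := by
  by_contra hV
  rw [not_nontrivial_iff_subsingleton] at hV
  obtain ⟨p, q, hpq⟩ := h.toNontrivial
  exact hpq (Subrepresentation.toSubmodule_injective (Subsingleton.elim _ _))

omit [CharZero k] [Finite G] in
/-- Every representation can be written in coordinates. -/
theorem exists_equiv_fin (ρ : Representation k G V) :
    ∃ ρ' : Representation k G (Fin (finrank k V) → k), Nonempty (Equiv ρ ρ') := by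
  let e : V ≃ₗ[k] (Fin (finrank k V) → k) := (finBasis k V).equivFun
  refine ⟨(e.conjAlgEquiv k : End k V →* End k _).comp ρ, ⟨Representation.Equiv.mk e fun g => ?_⟩⟩
  ext v
  simp

end General

/-! ### Change of scalars -/

section Scalars

variable {G : Type*} [Group G]

theorem char_extendScalars {K : Type*} (L : Type*) [Field K] [Field L] [Algebra K L]
    {W : Type*} [AddCommGroup W] [Module K W] [FiniteDimensional K W] (τ : Representation K G W)
    (g : G) : (extendScalars L τ).character g = algebraMap K L (τ.character g) :=
  LinearMap.trace_baseChange (τ g) L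

/-- Applying a field homomorphism to the matrices of a representation applies it to the
character. -/
theorem exists_map_character {F L : Type*} [Field F] [Field L] (s : F →+* L)
    {W : Type*} [AddCommGroup W] [Module F W] [FiniteDimensional F W] (τ : Representation F G W) :
    ∃ τ' : Representation L G (Fin (finrank F W) → L), ∀ g, τ'.character g = s (τ.character g) := by
  let _ : Algebra F L := s.toAlgebra
  have key : ∃ τ' : Representation L G (Fin (finrank L (L ⊗[F] W)) → L),
      ∀ g, τ'.character g = s (τ.character g) := by
    obtain ⟨τ', ⟨e⟩⟩ := exists_equiv_fin (extendScalars L τ)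
    exact ⟨τ', fun g => by rw [← char_iso e, char_extendScalars]; rfl⟩
  rwa [finrank_baseChange] at key

/-- Transitivity of the trace for an `F`-linear map. -/
theorem trace_restrictScalars (K : Type*) {F W : Type*} [Field K] [Field F] [Algebra K F]
    [FiniteDimensional K F]
    [AddCommGroup W] [Module K W] [Module F W] [IsScalarTower K F W] [FiniteDimensional F W]
    (f : W →ₗ[F] W) :
    LinearMap.trace K W (f.restrictScalars K) = Algebra.trace K F (LinearMap.trace F W f) := by
  classical
  let b := finBasis K F
  let c := finBasis F W
  rw [LinearMap.trace_eq_matrix_trace K (b.smulTower c), LinearMap.trace_eq_matrix_trace F c,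
    Matrix.trace, Matrix.trace, map_sum, Fintype.sum_prod_type, Finset.sum_comm]
  refine Finset.sum_congr rfl fun j _ => ?_
  rw [Algebra.trace_eq_matrix_trace b, Matrix.trace]
  refine Finset.sum_congr rfl fun i _ => ?_
  simp only [Matrix.diag_apply, LinearMap.toMatrix_apply, Algebra.leftMulMatrix_apply,
    Basis.smulTower_apply, Basis.smulTower_repr]
  simp [mul_comm]

/-- A representation over `F`, regarded as a representation over a subfield `K`. -/
def restrict (K : Type*) {F W : Type*} [Field K] [Field F] [Algebra K F]
    [AddCommGroup W] [Module K W] [Module F W] [IsScalarTower K F W] (τ : Representation F G W) :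
    Representation K G W where
  toFun g := (τ g).restrictScalars K
  map_one' := by rw [map_one]; rfl
  map_mul' g h := by rw [map_mul]; rfl

theorem char_restrict (K : Type*) {F W : Type*} [Field K] [Field F] [Algebra K F]
    [FiniteDimensional K F]
    [AddCommGroup W] [Module K W] [Module F W] [IsScalarTower K F W] [FiniteDimensional F W]
    (τ : Representation F G W) (g : G) :
    (restrict K τ).character g = Algebra.trace K F (τ.character g) :=
  trace_restrictScalars K (τ g)

end Scalars

/-! ### Complex representations -/

section Complex

variable {G : Type*} [Group G] [Finite G] {V W : Type*} [AddCommGroup V] [Module ℂ V]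
  [FiniteDimensional ℂ V] [AddCommGroup W] [Module ℂ W] [FiniteDimensional ℂ W]

omit [Finite G] in
/-- Irreducible complex representations with a common constituent are isomorphic. -/
theorem nonempty_equiv_of_finrank_hom {ρ : Representation ℂ G V} {σ : Representation ℂ G W}
    (hρ : ρ.IsIrreducible) (hσ : σ.IsIrreducible)
    (h : finrank ℂ (IntertwiningMap ρ σ) ≠ 0) : Nonempty (Representation.Equiv ρ σ) := by
  obtain ⟨f, hf⟩ := finrank_hom_ne_zero.1 h
  exact ⟨f.ofBijective ((IsIrreducible.bijective_or_eq_zero f).resolve_right hf)⟩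

theorem nonempty_equiv_of_character {ρ : Representation ℂ G V} {σ : Representation ℂ G W}
    (hρ : ρ.IsIrreducible) (hσ : σ.IsIrreducible) (h : ρ.character = σ.character) :
    Nonempty (Representation.Equiv ρ σ) := by
  refine nonempty_equiv_of_finrank_hom hρ hσ ?_
  rw [← finrank_hom_congr (ρ := ρ) h, IsIrreducible.finrank_intertwiningMap_self]
  exact one_ne_zero

theorem isIrreducible_of_character {ρ : Representation ℂ G V} {σ : Representation ℂ G W}
    (hρ : ρ.IsIrreducible) (h : ρ.character = σ.character) : σ.IsIrreducible := by
  apply isIrreducible_of_finrank_end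
  rw [← finrank_hom_congr (ρ := σ) h, finrank_hom_comm, ← finrank_hom_congr (ρ := ρ) h,
    IsIrreducible.finrank_intertwiningMap_self]

/-- The irreducible character afforded by an irreducible representation. -/
theorem exists_irrChar {ρ : Representation ℂ G V} (hρ : ρ.IsIrreducible) :
    ∃ χ : IrrChar G, χ.1 = ρ.character := by
  obtain ⟨ρ', ⟨e⟩⟩ := exists_equiv_fin ρ
  exact ⟨⟨ρ'.character, _, ρ', isIrreducible_of_character hρ (char_iso e), rfl⟩, (char_iso e).symm⟩

theorem IrrChar.nonempty_equiv {ρ : Representation ℂ G V} (hρ : ρ.IsIrreducible) {χ : IrrChar G}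
    (h : χ.1 = ρ.character) : Nonempty (Representation.Equiv χ.rep ρ) :=
  nonempty_equiv_of_character χ.rep_irreducible hρ (χ.rep_character.trans h)

open Classical in
theorem IrrChar.finrank_hom (χ : IrrChar G) {ρ : Representation ℂ G V} {χ' : IrrChar G}
    (h : χ'.1 = ρ.character) :
    finrank ℂ (IntertwiningMap χ.rep ρ) = if χ = χ' then 1 else 0 := by
  rw [← finrank_hom_congr (ρ := χ.rep) (χ'.rep_character.trans h)]
  have := χ.rep_irreducible
  split_ifs with hc
  · subst hc
    exact IsIrreducible.finrank_intertwiningMap_self _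
  · by_contra h0
    obtain ⟨e⟩ := nonempty_equiv_of_finrank_hom χ.rep_irreducible χ'.rep_irreducible h0
    exact hc (Subtype.ext (by rw [← χ.rep_character, ← χ'.rep_character, char_iso e]))

/-- The multiplicity of `χ` in a module with character `∑ nᵢ χᵢ`. -/
theorem IrrChar.finrank_hom_sum {ι : Type*} (s : Finset ι) (n : ι → ℕ) (c : ι → IrrChar G)
    (χ : IrrChar G) {ρ : Representation ℂ G V} (h : ρ.character = ∑ i ∈ s, n i • (c i).1)
    [DecidableEq (IrrChar G)] :
    finrank ℂ (IntertwiningMap χ.rep ρ) = ∑ i ∈ s, if χ = c i then n i else 0 := by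
  have := Fintype.ofFinite G
  rw [← Nat.cast_inj (R := ℂ), finrank_hom_eq, h, Nat.cast_sum]
  simp only [Finset.sum_apply, Finset.sum_mul]
  rw [Finset.sum_comm, Finset.mul_sum]
  refine Finset.sum_congr rfl fun i _ => ?_
  have h1 := finrank_hom_eq χ.rep (c i).rep
  rw [χ.finrank_hom (c i).rep_character.symm, (c i).rep_character] at h1
  simp only [Pi.smul_apply, nsmul_eq_mul, mul_assoc]
  rw [← Finset.mul_sum, mul_left_comm, ← h1]
  split_ifs <;> simp

/-- A complex module embeds into another one as soon as no irreducible module occurs in it with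
a larger multiplicity. -/
theorem exists_injective_of_finrank_hom_le {V : Type*} {W : Type*} [AddCommGroup V] [Module ℂ V]
    [FiniteDimensional ℂ V] [AddCommGroup W] [Module ℂ W] [FiniteDimensional ℂ W]
    (ρ : Representation ℂ G V) (σ : Representation ℂ G W)
    (h : ∀ χ : IrrChar G, finrank ℂ (IntertwiningMap χ.rep ρ) ≤
      finrank ℂ (IntertwiningMap χ.rep σ)) :
    ∃ f : IntertwiningMap ρ σ, Function.Injective f := by
  induction hd : finrank ℂ V using Nat.strong_induction_on generalizing V W with
  | _ d ih =>
  subst hd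
  rcases subsingleton_or_nontrivial V with hV | hV
  · exact ⟨0, fun _ _ _ => Subsingleton.elim _ _⟩
  obtain ⟨p, q, hp, ⟨e⟩⟩ := exists_irreducible_prod ρ
  obtain ⟨χ, hχ⟩ := exists_irrChar hp
  obtain ⟨i⟩ := IrrChar.nonempty_equiv hp hχ
  have hadd : ∀ χ' : IrrChar G, finrank ℂ (IntertwiningMap χ'.rep ρ) =
      finrank ℂ (IntertwiningMap χ'.rep p.toRepresentation) +
      finrank ℂ (IntertwiningMap χ'.rep q.toRepresentation) := fun χ' => by
    rw [← finrank_hom_congr (char_iso e), finrank_hom_prod]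
  have hne : finrank ℂ (IntertwiningMap χ.rep σ) ≠ 0 := by
    have h1 := h χ
    rw [hadd, χ.finrank_hom hχ, if_pos rfl] at h1
    omega
  obtain ⟨f, hf⟩ := finrank_hom_ne_zero.1 hne
  have := χ.rep_irreducible
  have hf' := (IsIrreducible.injective_or_eq_zero f).resolve_right hf
  let f' : IntertwiningMap p.toRepresentation σ := f.comp i.symm.toIntertwiningMap
  have hf'' : Function.Injective f' := hf'.comp i.symm.toLinearEquiv.injective
  obtain ⟨t, ⟨e'⟩⟩ := exists_equiv_prod f' hf''
  have hlt : finrank ℂ q.toSubmodule < finrank ℂ V := by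
    rw [← e.toLinearEquiv.finrank_eq, finrank_prod]
    have := nontrivial_of_isIrreducible _ hp
    have := finrank_pos (R := ℂ) (M := p.toSubmodule)
    omega
  obtain ⟨j, hj⟩ := ih _ hlt q.toRepresentation t.toRepresentation (fun χ' => by
    have h1 := h χ'
    rw [hadd, ← finrank_hom_congr (char_iso e'), finrank_hom_prod] at h1
    omega) rfl
  let F : IntertwiningMap (p.toRepresentation.prod q.toRepresentation)
      (p.toRepresentation.prod t.toRepresentation) :=
    (IntertwiningMap.fst ℂ _ _).prod (j.comp (IntertwiningMap.snd ℂ _ _))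
  have hF : Function.Injective F := by
    rintro ⟨a, b⟩ ⟨a', b'⟩ hab
    have h1 : (a, j b) = (a', j b') := hab
    rw [Prod.mk.injEq] at h1
    rw [h1.1, hj h1.2]
  exact ⟨e'.toIntertwiningMap.comp (F.comp e.symm.toIntertwiningMap),
    e'.toLinearEquiv.injective.comp (hF.comp e.symm.toLinearEquiv.injective)⟩

/-- Multiplicities grow along embeddings. -/
theorem finrank_hom_le_of_injective {U : Type*} [AddCommGroup U] [Module ℂ U]
    [FiniteDimensional ℂ U] {ρ : Representation ℂ G V} {σ : Representation ℂ G W}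
    (f : IntertwiningMap ρ σ) (hf : Function.Injective f) (π : Representation ℂ G U) :
    finrank ℂ (IntertwiningMap π ρ) ≤ finrank ℂ (IntertwiningMap π σ) := by
  obtain ⟨p, ⟨e⟩⟩ := exists_equiv_prod f hf
  rw [← finrank_hom_congr (char_iso e), finrank_hom_prod]
  omega

end Complex

/-! ### The field of scalars of an irreducible module -/

section Field

variable {G : Type*} [Group G]

/-- An irreducible module over `k` carries a commuting action of a finite extension field `F`
of `k` for which the only `F[G]`-endomorphisms are the elements of `F`. -/
theorem exists_field_end_eq_one.{u} {k : Type*} [Field k] {W : Type u} [AddCommGroup W]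
    [Module k W] [FiniteDimensional k W] {τ : Representation k G W} (hτ : τ.IsIrreducible) :
    ∃ (F : Type u) (_ : Field F) (_ : Algebra k F) (_ : FiniteDimensional k F) (_ : Module F W)
      (_ : IsScalarTower k F W) (τ' : Representation F G W),
      restrict k τ' = τ ∧ finrank F (IntertwiningMap τ' τ') = 1 := by
  classical
  -- The field is a maximal commutative subalgebra of the algebra of endomorphisms commuting
  -- with `G`.
  let P : Subalgebra k (End k W) → Prop := fun A =>
    (∀ x ∈ A, ∀ y ∈ A, x * y = y * x) ∧ ∀ x ∈ A, ∀ g, x * τ g = τ g * x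
  have hbot : P ⊥ := by
    constructor
    · rintro _ ⟨a, rfl⟩ y _
      exact Algebra.commutes a y
    · rintro _ ⟨a, rfl⟩ g
      exact Algebra.commutes a (τ g)
  have hwf : WellFounded ((· > ·) : Subalgebra k (End k W) → Subalgebra k (End k W) → Prop) :=
    Subrelation.wf (fun {A B} h => (Subalgebra.toSubmodule (R := k) (A := End k W)).lt_iff_lt.2 h)
      (InvImage.wf (fun A : Subalgebra k (End k W) => Subalgebra.toSubmodule A)
        (wellFounded_gt (α := Submodule k (End k W))))
  obtain ⟨A, ⟨hcomm, hA⟩, hmax⟩ := hwf.has_min {A | P A} ⟨⊥, hbot⟩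
  -- By maximality, `A` is its own centralizer in the endomorphism algebra of the module.
  have hmem : ∀ T : End k W, (∀ x ∈ A, x * T = T * x) → (∀ g, T * τ g = τ g * T) → T ∈ A := by
    intro T h1 h2
    have hs : ∀ x ∈ insert T (A : Set (End k W)), ∀ y ∈ insert T (A : Set (End k W)),
        x * y = y * x := by
      rintro x (rfl | hx) y (rfl | hy)
      · rfl
      · exact (h1 y hy).symm
      · exact h1 x hx
      · exact hcomm x hx y hy
    have hP : P (Algebra.adjoin k (insert T (A : Set (End k W)))) := by
      constructor
      · intro x hx y hy
        have := Algebra.isMulCommutative_adjoin k hs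
        exact setLike_mul_comm hx hy
      · intro x hx g
        induction hx using Algebra.adjoin_induction with
        | mem x hx =>
          rcases hx with rfl | hx
          · exact h2 g
          · exact hA x hx g
        | algebraMap r => exact Algebra.commutes r (τ g)
        | add x y _ _ hx hy => rw [add_mul, mul_add, hx, hy]
        | mul x y _ _ hx hy => rw [mul_assoc, hy, ← mul_assoc, hx, mul_assoc]
    have hle : A ≤ Algebra.adjoin k (insert T (A : Set (End k W))) := fun x hx =>
      Algebra.subset_adjoin (Set.mem_insert_of_mem _ hx)
    have hnot := hmax _ hP
    have heq : A = Algebra.adjoin k (insert T (A : Set (End k W))) := by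
      by_contra hne
      exact hnot (lt_of_le_of_ne hle hne)
    rw [heq]
    exact Algebra.subset_adjoin (Set.mem_insert _ _)
  -- Schur's lemma makes `A` a domain, hence a field.
  have hinj : ∀ x ∈ A, x ≠ 0 → Function.Injective x := by
    intro x hx hx0
    let f : IntertwiningMap τ τ := ⟨x, fun g => hA x hx g⟩
    refine (IsIrreducible.injective_or_eq_zero f).resolve_right fun h => hx0 ?_
    exact congrArg IntertwiningMap.toLinearMap h
  have hW : Nontrivial W := nontrivial_of_isIrreducible τ hτ
  let _ : CommRing A := { (inferInstance : Ring A) with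
    mul_comm := fun x y => Subtype.ext (hcomm x x.2 y y.2) }
  have : NoZeroDivisors A := ⟨fun {x y} hxy => by
    by_cases hx : x = 0
    · exact Or.inl hx
    · right
      refine Subtype.ext (LinearMap.ext fun w => hinj x x.2 (fun h => hx (Subtype.ext h)) ?_)
      have := congrArg (fun z : A => (z : End k W) w) hxy
      simpa using this⟩
  have : IsDomain A := NoZeroDivisors.to_isDomain A
  let _ : Field A := fieldOfFiniteDimensional k A
  let _ : Module A W := inferInstance
  have hsmul : ∀ (a : A) (w : W), a • w = (a : End k W) w := fun _ _ => rfl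
  let τ' : Representation A G W :=
    { toFun := fun g =>
        { toFun := τ g
          map_add' := map_add _
          map_smul' := fun a w => (congrArg (fun z : End k W => z w) (hA a a.2 g)).symm }
      map_one' := by ext; simp
      map_mul' := fun g h => by ext; simp }
  have htow : IsScalarTower k A W := ⟨fun c a w => rfl⟩
  refine ⟨A, inferInstance, inferInstance, inferInstance, inferInstance, htow, τ', ?_, ?_⟩
  · rfl
  have h1 : (1 : IntertwiningMap τ' τ') ≠ 0 := by
    intro h
    obtain ⟨w, hw⟩ := exists_ne (0 : W)
    exact hw (congrArg (fun f : IntertwiningMap τ' τ' => f w) h)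
  refine (finrank_eq_one_iff_of_nonzero' _ h1).2 fun T => ?_
  let T' : End k W := T.toLinearMap.restrictScalars k
  refine ⟨⟨T', hmem T' (fun x hx => ?_) fun g => ?_⟩, ?_⟩
  · ext w
    exact (T.toLinearMap.map_smul (⟨x, hx⟩ : A) w).symm
  · ext w
    exact congrArg (fun f => f w) (T.isIntertwining' g)
  · rfl

end Field

/-! ### Galois conjugates and embeddings of fields -/

section Galois

variable {G : Type*} [Group G]

/-- The number of embeddings of a finite extension `L` of `K` that extend a given embedding of
`K`. -/
theorem card_algHom_fiber {K L : Type*} [Field K] [CharZero K] [Field L] [CharZero L] [Algebra K L]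
    [FiniteDimensional K L] (κ : K →ₐ[ℚ] ℂ) :
    Nat.card {s : L →ₐ[ℚ] ℂ // ∀ a : K, s (algebraMap K L a) = κ a} = finrank K L := by
  let _ : Algebra K ℂ := κ.toRingHom.toAlgebra
  rw [← AlgHom.card K L ℂ, ← Nat.card_eq_fintype_card]
  exact Nat.card_congr
    { toFun := fun s => { s.1.toRingHom with commutes' := fun a => s.2 a }
      invFun := fun t => ⟨t.toRingHom.toRatAlgHom, fun a => t.commutes a⟩
      left_inv := fun s => by ext; rfl
      right_inv := fun t => by ext; rfl }

/-- The character field of an irreducible character. -/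
noncomputable abbrev IrrChar.field (χ : IrrChar G) : IntermediateField ℚ ℂ := charField χ.rep.character

theorem IrrChar.apply_mem_field (χ : IrrChar G) (g : G) : χ.1 g ∈ χ.field :=
  IntermediateField.subset_adjoin ℚ _ ⟨g, by rw [χ.rep_character]⟩

theorem IrrChar.algHom_ext (χ : IrrChar G) {κ κ' : χ.field →ₐ[ℚ] ℂ}
    (h : ∀ g, κ ⟨χ.1 g, χ.apply_mem_field g⟩ = κ' ⟨χ.1 g, χ.apply_mem_field g⟩) : κ = κ' := by
  refine IntermediateField.algHom_ext_of_eq_adjoin ℚ rfl ?_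
  rintro _ ⟨g, rfl⟩
  have e : (⟨χ.rep.character g, IntermediateField.subset_adjoin ℚ _ ⟨g, rfl⟩⟩ : χ.field) =
      ⟨χ.1 g, χ.apply_mem_field g⟩ := Subtype.ext (congrFun χ.rep_character g)
  exact (congrArg κ e).trans ((h g).trans (congrArg κ' e.symm))

variable [Finite G]

instance IrrChar.finiteDimensional_field (χ : IrrChar G) : FiniteDimensional ℚ χ.field := by
  refine IntermediateField.finiteDimensional_adjoin ?_
  rintro _ ⟨g, rfl⟩
  exact (isAlgebraic_character χ.rep g).isIntegral

theorem IrrChar.field_le (χ : IrrChar G) : χ.field ≤ algebraicClosure ℚ ℂ := by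
  refine IntermediateField.adjoin_le_iff.2 ?_
  rintro _ ⟨g, rfl⟩
  exact mem_algebraicClosure_iff.2 (isAlgebraic_character χ.rep g)

/-- The conjugates of `χ` are its images under the embeddings of the character field. -/
theorem IrrChar.galois_iff (χ χ' : IrrChar G) : (IrrChar.galoisSetoid G).r χ χ' ↔
    ∃ κ : χ.field →ₐ[ℚ] ℂ, ∀ g, κ ⟨χ.1 g, χ.apply_mem_field g⟩ = χ'.1 g := by
  constructor
  · rintro ⟨γ, hγ⟩
    refine ⟨((algebraicClosure ℚ ℂ).val.comp γ.toAlgHom).comp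
      (IntermediateField.inclusion χ.field_le), fun g => ?_⟩
    exact (congrArg Subtype.val (hγ g)).symm
  · rintro ⟨κ, hκ⟩
    -- `κ` extends to the algebraic closure, where the extension is bijective.
    let _ : Algebra χ.field (algebraicClosure ℚ ℂ) :=
      (IntermediateField.inclusion χ.field_le).toRingHom.toAlgebra
    have : IsScalarTower ℚ χ.field (algebraicClosure ℚ ℂ) := IsScalarTower.of_algebraMap_eq
      fun q => ((IntermediateField.inclusion χ.field_le).commutes q).symm
    have : Algebra.IsAlgebraic ℚ (algebraicClosure ℚ ℂ) :=
      algebraicClosure.isAlgebraic ℚ ℂ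
    have : Algebra.IsAlgebraic χ.field (algebraicClosure ℚ ℂ) :=
      Algebra.IsAlgebraic.tower_top (K := ℚ) χ.field
    obtain ⟨φ, hφ⟩ := IsAlgClosed.surjective_domRestrict_of_isAlgebraic
      (K := ℚ) (L := χ.field) (M := ℂ) (E := algebraicClosure ℚ ℂ) κ
    have hmem : ∀ a, φ a ∈ algebraicClosure ℚ ℂ := fun a =>
      mem_algebraicClosure_iff.2 ((Algebra.IsAlgebraic.isAlgebraic a).algHom φ)
    let φ' : algebraicClosure ℚ ℂ →ₐ[ℚ] algebraicClosure ℚ ℂ :=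
      φ.codRestrict (algebraicClosure ℚ ℂ).toSubalgebra hmem
    refine ⟨AlgEquiv.ofBijective φ' (Algebra.IsAlgebraic.algHom_bijective φ'), fun g => ?_⟩
    refine Subtype.ext ?_
    change χ'.1 g = φ (χ.algVal g)
    rw [← hκ g, ← hφ]
    rfl

/-- The number of embeddings of `L` that map `χ` to `χ'`. -/
theorem IrrChar.card_algHom (χ χ' : IrrChar G) (L : IntermediateField χ.field ℂ)
    [FiniteDimensional χ.field L] (ψ : G → L) (hψ : ∀ g, (ψ g : ℂ) = χ.1 g)
    [Decidable ((IrrChar.galoisSetoid G).r χ χ')] :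
    Nat.card {s : L →ₐ[ℚ] ℂ // ∀ g, s (ψ g) = χ'.1 g} =
      if (IrrChar.galoisSetoid G).r χ χ' then finrank χ.field L else 0 := by
  have hψ' : ∀ g, algebraMap χ.field L ⟨χ.1 g, χ.apply_mem_field g⟩ = ψ g := fun g =>
    Subtype.ext (hψ g).symm
  split_ifs with h
  · obtain ⟨κ, hκ⟩ := (χ.galois_iff χ').1 h
    rw [← card_algHom_fiber (K := χ.field) (L := L) κ]
    refine Nat.card_congr (Equiv.subtypeEquivRight fun s => ⟨fun hs => ?_, fun hs g => ?_⟩)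
    · let s' : χ.field →ₐ[ℚ] ℂ := (s.toRingHom.comp (algebraMap χ.field L)).toRatAlgHom
      have : s' = κ := χ.algHom_ext fun g => by
        rw [hκ, ← hs, ← hψ']
        rfl
      intro a
      exact congrArg (fun t => t a) this
    · rw [← hκ, ← hs, hψ']
  · refine Nat.card_eq_zero.2 (Or.inl ⟨fun ⟨s, hs⟩ => h ((χ.galois_iff χ').2 ?_)⟩)
    refine ⟨(s.toRingHom.comp (algebraMap χ.field L)).toRatAlgHom, fun g => ?_⟩
    rw [← hs, ← hψ']
    rfl

end Galois

/-! ### Rational representations obtained by restriction of scalars -/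

section Trace

variable {G : Type*} [Group G] [Finite G]

/-- Applying an embedding to an absolutely irreducible character gives an irreducible complex
character. -/
theorem exists_irrChar_of_finrank_end {F W : Type*} [Field F] [CharZero F] [AddCommGroup W]
    [Module F W] [FiniteDimensional F W] (τ : Representation F G W)
    (h : finrank F (IntertwiningMap τ τ) = 1) (s : F →+* ℂ) :
    ∃ χ : IrrChar G, ∀ g, χ.1 g = s (τ.character g) := by
  have := Fintype.ofFinite G
  obtain ⟨τ', hτ'⟩ := exists_map_character s τ
  have hirr : τ'.IsIrreducible := by
    apply isIrreducible_of_finrank_end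
    -- The embedding `s` carries the scalar product `⟨ψ, ψ⟩ = 1` over `F` to the one over `ℂ`.
    rw [← Nat.cast_inj (R := ℂ), finrank_hom_eq]
    have h1 := congrArg s (finrank_hom_eq τ τ)
    rw [h] at h1
    simp only [hτ']
    simpa using h1.symm
  obtain ⟨χ, hχ⟩ := exists_irrChar hirr
  exact ⟨χ, fun g => by rw [hχ, hτ']⟩

/-- A representation over a subfield of `ℂ` with an irreducible complex character is absolutely
irreducible. -/
theorem IrrChar.finrank_end_of_character {F W : Type*} [Field F] [CharZero F] [AddCommGroup W]
    [Module F W] [FiniteDimensional F W] (τ : Representation F G W) (s : F →+* ℂ) (χ : IrrChar G)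
    (h : ∀ g, s (τ.character g) = χ.1 g) : finrank F (IntertwiningMap τ τ) = 1 := by
  have := Fintype.ofFinite G
  have h1 := congrArg s (finrank_hom_eq τ τ)
  have h2 := finrank_hom_eq χ.rep χ.rep
  have := χ.rep_irreducible
  rw [IsIrreducible.finrank_intertwiningMap_self, χ.rep_character] at h2
  rw [← Nat.cast_inj (R := ℂ), h2, ← map_natCast s, h1]
  simp [h]

open Classical in
/-- Multiplicities in a rational module whose character is the trace of an absolutely irreducible
character `ψ`: they count embeddings. -/
theorem IrrChar.finrank_hom_trace {F U W : Type*} [Field F] [CharZero F] [FiniteDimensional ℚ F]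
    [AddCommGroup U] [Module F U] [FiniteDimensional F U] (τF : Representation F G U)
    (h : finrank F (IntertwiningMap τF τF) = 1)
    [AddCommGroup W] [Module ℚ W] [FiniteDimensional ℚ W] (τ : Representation ℚ G W)
    (hτ : ∀ g, τ.character g = Algebra.trace ℚ F (τF.character g)) (χ : IrrChar G) :
    finrank ℂ (IntertwiningMap χ.rep (extendScalars ℂ τ)) =
      Nat.card {s : F →ₐ[ℚ] ℂ // ∀ g, s (τF.character g) = χ.1 g} := by
  choose c hc using fun s : F →ₐ[ℚ] ℂ => exists_irrChar_of_finrank_end τF h s.toRingHom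
  have h1 : (extendScalars ℂ τ).character = ∑ s : F →ₐ[ℚ] ℂ, 1 • (c s).1 := by
    ext g
    rw [char_extendScalars, hτ, trace_eq_sum_embeddings ℂ, Finset.sum_apply]
    refine Finset.sum_congr rfl fun s _ => ?_
    rw [one_smul, hc]
    rfl
  rw [χ.finrank_hom_sum Finset.univ (fun _ => 1) c h1, Finset.sum_boole, Nat.cast_id,
    Nat.card_eq_fintype_card, Fintype.card_subtype]
  refine congrArg Finset.card (Finset.filter_congr fun s _ => ⟨?_, fun hs => ?_⟩)
  · rintro rfl g
    exact (hc s g).symm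
  · exact Subtype.ext (funext fun g => ((hc s g).trans (hs g)).symm)

open Classical in
/-- Restricting a realization of `χ` over `L` to `ℚ` gives each conjugate of `χ` with
multiplicity `[L : ℚ(χ)]`. -/
theorem IrrChar.finrank_hom_realization (χ : IrrChar G) (L : IntermediateField χ.field ℂ)
    [FiniteDimensional χ.field L] {U W : Type*} [AddCommGroup U] [Module L U]
    [FiniteDimensional L U] (τL : Representation L G U) (hL : ∀ g, (τL.character g : ℂ) = χ.1 g)
    [AddCommGroup W] [Module ℚ W] [FiniteDimensional ℚ W] (τ : Representation ℚ G W)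
    (hτ : ∀ g, τ.character g = Algebra.trace ℚ L (τL.character g)) (χ' : IrrChar G) :
    finrank ℂ (IntertwiningMap χ'.rep (extendScalars ℂ τ)) =
      if (IrrChar.galoisSetoid G).r χ χ' then finrank χ.field L else 0 := by
  have : FiniteDimensional ℚ L := FiniteDimensional.trans ℚ χ.field L
  rw [IrrChar.finrank_hom_trace τL
    (χ.finrank_end_of_character τL (algebraMap L ℂ) hL) τ hτ χ', ← χ.card_algHom χ' L _ hL]

omit [Finite G] in
/-- The dimension over `ℚ` of the restriction of a realization of `χ`. -/
theorem IrrChar.finrank_eq_of_realization (χ : IrrChar G) (L : IntermediateField χ.field ℂ)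
    [FiniteDimensional χ.field L] [FiniteDimensional ℚ χ.field]
    {U W : Type*} [AddCommGroup U] [Module L U]
    [FiniteDimensional L U] (τL : Representation L G U) (hL : ∀ g, (τL.character g : ℂ) = χ.1 g)
    [AddCommGroup W] [Module ℚ W] [FiniteDimensional ℚ W] (τ : Representation ℚ G W)
    (hτ : ∀ g, τ.character g = Algebra.trace ℚ L (τL.character g)) :
    finrank ℚ W = finrank χ.field L * finrank ℚ χ.field * χ.deg := by
  have : FiniteDimensional ℚ L := FiniteDimensional.trans ℚ χ.field L
  have h1 := hL 1
  rw [char_one, ← χ.rep_character, char_one, finrank_fin_fun] at h1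
  have h2 : finrank L U = χ.deg := by exact_mod_cast h1
  have h3 := hτ 1
  have : Module.Free χ.field L := Module.Free.of_divisionRing _ _
  have h5 : finrank ℚ χ.field * finrank χ.field L = finrank ℚ L :=
    finrank_mul_finrank ℚ χ.field L
  rw [char_one, char_one, h2, ← map_natCast (algebraMap ℚ L), Algebra.trace_algebraMap,
    ← h5] at h3
  have h4 : ((finrank ℚ W : ℕ) : ℚ) =
      (((finrank ℚ χ.field * finrank χ.field L) * χ.deg : ℕ) : ℚ) := by
    rw [h3]; simp
  rw [Nat.cast_inj.1 h4]
  ring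

/-- An irreducible rational module containing `χ` comes, by restriction of scalars, from a
realization of `χ` over a finite extension of `ℚ(χ)`. -/
theorem IrrChar.exists_realization (χ : IrrChar G) {W : Type*} [AddCommGroup W] [Module ℚ W]
    [FiniteDimensional ℚ W] {τ : Representation ℚ G W} (hτ : τ.IsIrreducible)
    (h : finrank ℂ (IntertwiningMap χ.rep (extendScalars ℂ τ)) ≠ 0) :
    ∃ (L : IntermediateField χ.field ℂ) (_ : FiniteDimensional χ.field L) (n : ℕ)
      (τL : Representation L G (Fin n → L)), (∀ g, (τL.character g : ℂ) = χ.1 g) ∧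
      ∀ g, τ.character g = Algebra.trace ℚ L (τL.character g) := by
  obtain ⟨F, _, algF, _, _, _, τ', rfl, hF⟩ := exists_field_end_eq_one hτ
  have : CharZero F := charZero_of_injective_algebraMap (algebraMap ℚ F).injective
  -- The inclusion of `ℚ` into the field is unique, so the canonical one can be used.
  obtain rfl : algF = DivisionRing.toRatAlgebra := Subsingleton.elim _ _
  have : FiniteDimensional F W := FiniteDimensional.right ℚ F W
  have hchar := char_restrict ℚ τ'
  -- Since `χ` occurs, some embedding `s` maps the character of `τ'` to `χ`, and `L` is its image.
  have hcard := IrrChar.finrank_hom_trace τ' hF _ hchar χ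
  rw [hcard, Nat.card_ne_zero] at h
  obtain ⟨⟨s, hs⟩⟩ := h.1
  have hle : χ.field ≤ s.fieldRange := by
    refine IntermediateField.adjoin_le_iff.2 ?_
    rintro _ ⟨g, rfl⟩
    exact ⟨τ'.character g, by rw [χ.rep_character]; exact hs g⟩
  let L : IntermediateField χ.field ℂ := IntermediateField.extendScalars hle
  let e : F →+* L := s.toRingHom.codRestrict L fun a => ⟨a, rfl⟩
  have he : Function.Bijective e := by
    refine ⟨e.injective, ?_⟩
    rintro ⟨x, hx⟩
    obtain ⟨a, ha⟩ := hx
    exact ⟨a, Subtype.ext ha⟩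
  let e' : F ≃ₐ[ℚ] L := (RingEquiv.ofBijective e he).toRatAlgEquiv
  have : FiniteDimensional ℚ L := e'.toLinearEquiv.finiteDimensional
  have : FiniteDimensional χ.field L := FiniteDimensional.right ℚ χ.field L
  obtain ⟨τL, hτL⟩ := exists_map_character e τ'
  refine ⟨L, this, _, τL, fun g => ?_, fun g => ?_⟩
  · rw [hτL]
    exact hs g
  · rw [hchar, hτL]
    exact (Algebra.trace_eq_of_algEquiv e' _).symm

end Trace

/-! ### Irreducible rational representations -/

section Rational

variable {G : Type*} [Group G] [Finite G]

/-- The multiplicity of `χ` in `ℂ ⊗ W`, for a `ℚ[G]`-module `W`. -/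
noncomputable def IrrChar.mult (χ : IrrChar G) {W : Type*} [AddCommGroup W] [Module ℚ W]
    (τ : Representation ℚ G W) : ℕ :=
  finrank ℂ (IntertwiningMap χ.rep (extendScalars ℂ τ))

variable {W W' : Type*} [AddCommGroup W] [Module ℚ W] [FiniteDimensional ℚ W]
  [AddCommGroup W'] [Module ℚ W'] [FiniteDimensional ℚ W']

theorem IrrChar.mult_congr (χ : IrrChar G) {τ : Representation ℚ G W}
    {τ' : Representation ℚ G W'} (h : τ.character = τ'.character) : χ.mult τ = χ.mult τ' := by
  refine finrank_hom_congr ?_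
  ext g
  rw [char_extendScalars, char_extendScalars, h]

theorem IrrChar.mult_prod (χ : IrrChar G) (τ : Representation ℚ G W)
    (τ' : Representation ℚ G W') : χ.mult (τ.prod τ') = χ.mult τ + χ.mult τ' := by
  unfold IrrChar.mult
  rw [← finrank_hom_prod]
  refine finrank_hom_congr ?_
  ext g
  rw [char_extendScalars, char_prod, char_prod]
  simp [char_extendScalars]

/-- The number of independent intertwining maps does not change under extension of scalars. -/
theorem finrank_hom_extendScalars (τ : Representation ℚ G W) (τ' : Representation ℚ G W') :
    finrank ℂ (IntertwiningMap (extendScalars ℂ τ) (extendScalars ℂ τ')) =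
      finrank ℚ (IntertwiningMap τ τ') := by
  have := Fintype.ofFinite G
  have h := congrArg (algebraMap ℚ ℂ) (finrank_hom_eq τ τ')
  rw [← Nat.cast_inj (R := ℂ), finrank_hom_eq]
  rw [map_natCast] at h
  rw [h]
  simp [char_extendScalars]

omit [Finite G] in
theorem IrrChar.exists_injective (χ : IrrChar G) {τ : Representation ℚ G W} (h : χ.mult τ ≠ 0) :
    ∃ f : IntertwiningMap χ.rep (extendScalars ℂ τ), Function.Injective f := by
  obtain ⟨f, hf⟩ := finrank_hom_ne_zero.1 h
  have := χ.rep_irreducible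
  exact ⟨f, (IsIrreducible.injective_or_eq_zero f).resolve_right hf⟩

theorem IrrChar.mult_ne_zero_of_injective (χ : IrrChar G) {τ : Representation ℚ G W}
    (f : IntertwiningMap χ.rep (extendScalars ℂ τ)) (hf : Function.Injective f) :
    χ.mult τ ≠ 0 := by
  have h := finrank_hom_le_of_injective f hf χ.rep
  have := χ.rep_irreducible
  rw [IsIrreducible.finrank_intertwiningMap_self] at h
  exact (Nat.lt_of_lt_of_le Nat.zero_lt_one h).ne'

/-- Irreducible rational modules with a common complex constituent are isomorphic. -/
theorem IrrChar.nonempty_equiv_of_mult (χ : IrrChar G) {τ : Representation ℚ G W}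
    {τ' : Representation ℚ G W'} (hτ : τ.IsIrreducible) (hτ' : τ'.IsIrreducible)
    (h : χ.mult τ ≠ 0) (h' : χ.mult τ' ≠ 0) : Nonempty (Representation.Equiv τ τ') := by
  obtain ⟨f, hf⟩ := χ.exists_injective h
  obtain ⟨f', hf'⟩ := χ.exists_injective h'
  obtain ⟨r, hr⟩ := exists_leftInverse_of_injective f hf
  have hne : finrank ℂ (IntertwiningMap (extendScalars ℂ τ) (extendScalars ℂ τ')) ≠ 0 := by
    refine finrank_hom_ne_zero.2 ⟨f'.comp r, fun h0 => ?_⟩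
    have := nontrivial_of_isIrreducible _ χ.rep_irreducible
    obtain ⟨v, hv⟩ := exists_ne (0 : Fin χ.deg → ℂ)
    have h1 : f' (r (f v)) = 0 := congrArg (fun t => t (f v)) h0
    rw [hr] at h1
    exact hv (hf' (h1.trans (map_zero f').symm))
  rw [finrank_hom_extendScalars] at hne
  obtain ⟨t, ht⟩ := finrank_hom_ne_zero.1 hne
  exact ⟨t.ofBijective ((IsIrreducible.bijective_or_eq_zero t).resolve_right ht)⟩

/-- A rational module containing `χ` has an irreducible constituent containing `χ`. -/
theorem IrrChar.exists_irreducible.{u} (χ : IrrChar G) {W : Type u} [AddCommGroup W] [Module ℚ W]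
    [FiniteDimensional ℚ W] (τ : Representation ℚ G W) (h : χ.mult τ ≠ 0) :
    ∃ (W' : Type u) (_ : AddCommGroup W') (_ : Module ℚ W') (_ : FiniteDimensional ℚ W')
      (τ' : Representation ℚ G W'), τ'.IsIrreducible ∧ χ.mult τ' ≠ 0 ∧ χ.mult τ' ≤ χ.mult τ ∧
        finrank ℚ W' ≤ finrank ℚ W := by
  induction hd : finrank ℚ W using Nat.strong_induction_on generalizing W with
  | _ d ih =>
  subst hd
  rcases subsingleton_or_nontrivial W with hW | hW
  · exfalso
    obtain ⟨f, hf⟩ := χ.exists_injective h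
    have := nontrivial_of_isIrreducible _ χ.rep_irreducible
    exact not_subsingleton _ (hf.subsingleton (α := Fin χ.deg → ℂ))
  obtain ⟨p, q, hp, ⟨e⟩⟩ := exists_irreducible_prod τ
  have h1 := χ.mult_congr (char_iso e)
  rw [χ.mult_prod] at h1
  have h2 := e.toLinearEquiv.finrank_eq
  rw [finrank_prod] at h2
  by_cases h3 : χ.mult p.toRepresentation = 0
  · have := nontrivial_of_isIrreducible _ hp
    have := finrank_pos (R := ℚ) (M := p.toSubmodule)
    obtain ⟨W', _, _, _, τ', h4, h5, h6, h7⟩ :=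
      ih (finrank ℚ q.toSubmodule) (by omega) q.toRepresentation (by omega) rfl
    exact ⟨W', _, _, ‹_›, τ', h4, h5, by omega, by omega⟩
  · exact ⟨_, _, _, inferInstance, p.toRepresentation, hp, h3, by omega, by omega⟩

/-- Every irreducible complex module is contained in a rational one, the regular one. -/
theorem exists_rational_mult_ne_zero (G : Type*) [Group G] [Finite G] :
    ∃ (n : ℕ) (τ : Representation ℚ G (Fin n → ℚ)), ∀ χ : IrrChar G, χ.mult τ ≠ 0 := by
  classical
  have := Fintype.ofFinite G
  let R : Representation ℚ G (G → ℚ) :=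
    { toFun := fun g => LinearMap.funLeft ℚ ℚ fun x => g⁻¹ * x
      map_one' := by ext; simp [LinearMap.funLeft_apply]
      map_mul' := fun g h => by ext; simp [LinearMap.funLeft_apply, mul_assoc] }
  have hR : ∀ g, R.character g = if g = 1 then (Nat.card G : ℚ) else 0 := by
    intro g
    rw [Representation.character, LinearMap.trace_eq_matrix_trace ℚ (Pi.basisFun ℚ G),
      Matrix.trace]
    have : ∀ x, Matrix.diag (LinearMap.toMatrix (Pi.basisFun ℚ G) (Pi.basisFun ℚ G) (R g)) x =
        if g = 1 then 1 else 0 := by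
      intro x
      rw [Matrix.diag_apply, LinearMap.toMatrix_apply, Pi.basisFun_repr, Pi.basisFun_apply]
      change (Pi.single x (1 : ℚ) : G → ℚ) (g⁻¹ * x) = _
      rw [Pi.single_apply]
      simp
    simp only [this, Finset.sum_const, Finset.card_univ, nsmul_eq_mul, Nat.card_eq_fintype_card]
    split_ifs <;> simp
  obtain ⟨τ, ⟨e⟩⟩ := exists_equiv_fin R
  refine ⟨_, τ, fun χ => ?_⟩
  rw [← χ.mult_congr (char_iso e)]
  have h1 := finrank_hom_eq χ.rep (extendScalars ℂ R)
  have hN : (Nat.card G : ℂ) ≠ 0 := Nat.cast_ne_zero.2 Nat.card_pos.ne'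
  have h2 : ∑ g : G, (extendScalars ℂ R).character g * χ.rep.character g⁻¹ =
      Nat.card G * χ.rep.character 1 := by
    rw [Finset.sum_eq_single 1]
    · rw [char_extendScalars, hR, if_pos rfl, inv_one]
      simp
    · intro g _ hg
      rw [char_extendScalars, hR, if_neg hg, map_zero, zero_mul]
    · intro h
      exact absurd (Finset.mem_univ _) h
  rw [h2, inv_mul_cancel_left₀ hN, char_one, Nat.cast_inj] at h1
  have := nontrivial_of_isIrreducible _ χ.rep_irreducible
  rw [IrrChar.mult, h1]
  exact finrank_pos.ne'

/-- Every irreducible character occurs in some irreducible rational module. -/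
theorem IrrChar.exists_irreducible_mult (χ : IrrChar G) :
    ∃ (W : Type) (_ : AddCommGroup W) (_ : Module ℚ W) (_ : FiniteDimensional ℚ W)
      (τ : Representation ℚ G W), τ.IsIrreducible ∧ χ.mult τ ≠ 0 := by
  obtain ⟨n, τ, hτ⟩ := exists_rational_mult_ne_zero G
  obtain ⟨W', i1, i2, i3, τ', h1, h2, -⟩ := χ.exists_irreducible τ (hτ χ)
  exact ⟨W', i1, i2, i3, τ', h1, h2⟩

omit [Finite G] in
theorem character_of_realizableOver {V : Type*} [AddCommGroup V] [Module ℂ V] {L : Type} [Field L]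
    [Algebra L ℂ] {ρ : Representation ℂ G V} (h : RealizableOver L ρ) :
    ∃ (W : Type) (_ : AddCommGroup W) (_ : Module L W) (_ : FiniteDimensional L W)
      (τ : Representation L G W), ∀ g, algebraMap L ℂ (τ.character g) = ρ.character g := by
  obtain ⟨W, i1, i2, i3, τ, ⟨e⟩⟩ := h
  exact ⟨W, i1, i2, i3, τ, fun g => by rw [← char_iso e, char_extendScalars]⟩

theorem realizableOver_of_character {V : Type*} [AddCommGroup V] [Module ℂ V]
    [FiniteDimensional ℂ V] {L : Type} [Field L] [Algebra L ℂ] {ρ : Representation ℂ G V}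
    (hρ : ρ.IsIrreducible) {W : Type} [AddCommGroup W] [Module L W] [FiniteDimensional L W]
    (τ : Representation L G W) (h : ∀ g, algebraMap L ℂ (τ.character g) = ρ.character g) :
    RealizableOver L ρ := by
  have h1 : ρ.character = (extendScalars ℂ τ).character := by
    ext g
    rw [char_extendScalars, h]
  exact ⟨W, _, _, ‹_›, τ, nonempty_equiv_of_character (isIrreducible_of_character hρ h1) hρ h1.symm⟩

open Classical in
/-- The complex constituents of an irreducible rational module containing `χ`: they are the
conjugates of `χ`, and each occurs with multiplicity the Schur index of `χ`. -/
theorem IrrChar.mult_eq (χ : IrrChar G) {τ : Representation ℚ G W}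
    (hτ : τ.IsIrreducible) (h : χ.mult τ ≠ 0) (χ' : IrrChar G) :
    χ'.mult τ = if (IrrChar.galoisSetoid G).r χ χ' then χ.schurIndex else 0 := by
  obtain ⟨L, _, n, τL, hL, htr⟩ := χ.exists_realization hτ h
  have h1 : ∀ χ' : IrrChar G, χ'.mult τ = _ := χ.finrank_hom_realization L τL hL τ htr
  have hrefl : (IrrChar.galoisSetoid G).r χ χ := (IrrChar.galoisSetoid G).iseqv.refl χ
  suffices hm : χ.schurIndex = finrank χ.field L by rw [h1, hm]
  have hmem : finrank χ.field L ∈ {d | ∃ L : IntermediateField χ.field ℂ,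
      FiniteDimensional χ.field L ∧ RealizableOver L χ.rep ∧ finrank χ.field L = d} := by
    refine ⟨L, inferInstance, realizableOver_of_character χ.rep_irreducible τL fun g => ?_, rfl⟩
    rw [χ.rep_character]
    exact hL g
  refine le_antisymm (Nat.sInf_le hmem) ?_
  -- A realization over an extension `L'` of least degree restricts to a rational module in which
  -- `χ` has multiplicity `[L' : ℚ(χ)]`; it contains a copy of the given irreducible module, in
  -- which the multiplicity is `[L : ℚ(χ)]`.
  obtain ⟨L', _, hreal, hd⟩ := Nat.sInf_mem ⟨_, hmem⟩
  rw [IrrChar.schurIndex, RatSpan.schurIndex, ← hd]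
  obtain ⟨U, _, _, _, τU, hU⟩ := character_of_realizableOver hreal
  rw [χ.rep_character] at hU
  have : FiniteDimensional ℚ L' := FiniteDimensional.trans ℚ χ.field L'
  let _ : Module ℚ U := Module.compHom U (algebraMap ℚ L')
  have : IsScalarTower ℚ L' U := IsScalarTower.of_compHom ℚ L' U
  have : FiniteDimensional ℚ U := FiniteDimensional.trans ℚ L' U
  have h2 : ∀ χ' : IrrChar G, χ'.mult (restrict ℚ τU) = _ :=
    χ.finrank_hom_realization L' τU hU (restrict ℚ τU) (char_restrict ℚ τU)
  have h3 := h2 χ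
  rw [if_pos hrefl] at h3
  have hpos : 0 < finrank χ.field L' := finrank_pos
  obtain ⟨W', _, _, _, τ', h4, h5, h6, -⟩ := χ.exists_irreducible (restrict ℚ τU) (by omega)
  obtain ⟨e⟩ := χ.nonempty_equiv_of_mult hτ h4 h h5
  have h7 := h1 χ
  rw [if_pos hrefl, χ.mult_congr (char_iso e)] at h7
  omega

theorem IrrChar.mult_self (χ : IrrChar G) {τ : Representation ℚ G W}
    (hτ : τ.IsIrreducible) (h : χ.mult τ ≠ 0) : χ.mult τ = χ.schurIndex := by
  classical
  rw [χ.mult_eq hτ h, if_pos ((IrrChar.galoisSetoid G).iseqv.refl χ)]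

theorem IrrChar.finrank_eq (χ : IrrChar G) {τ : Representation ℚ G W}
    (hτ : τ.IsIrreducible) (h : χ.mult τ ≠ 0) :
    finrank ℚ W = χ.schurIndex * finrank ℚ χ.field * χ.deg := by
  classical
  obtain ⟨L, _, n, τL, hL, htr⟩ := χ.exists_realization hτ h
  have h1 : χ.mult τ = _ := χ.finrank_hom_realization L τL hL τ htr χ
  rw [if_pos ((IrrChar.galoisSetoid G).iseqv.refl χ), χ.mult_self hτ h] at h1
  rw [h1]
  exact χ.finrank_eq_of_realization L τL hL τ htr

/-- The rational span of `χ` is the irreducible rational module containing `χ`. -/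
theorem IrrChar.sigma_eq (χ : IrrChar G) {W : Type} [AddCommGroup W] [Module ℚ W]
    [FiniteDimensional ℚ W] {τ : Representation ℚ G W}
    (hτ : τ.IsIrreducible) (h : χ.mult τ ≠ 0) : χ.sigma = finrank ℚ W := by
  obtain ⟨f, hf⟩ := χ.exists_injective h
  have hmem : finrank ℚ W ∈ spanDims χ.rep := ⟨W, _, _, ‹_›, τ, f, hf, rfl⟩
  refine le_antisymm (Nat.sInf_le hmem) ?_
  obtain ⟨W', _, _, _, τ', f', hf', hd⟩ := Nat.sInf_mem ⟨_, hmem⟩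
  rw [IrrChar.sigma, RatSpan.sigma, ← hd]
  obtain ⟨W'', _, _, _, τ'', h4, h5, -, h7⟩ :=
    χ.exists_irreducible τ' (χ.mult_ne_zero_of_injective f' hf')
  obtain ⟨e⟩ := χ.nonempty_equiv_of_mult hτ h4 h h5
  rw [e.toLinearEquiv.finrank_eq]
  exact h7

theorem IrrChar.sigma_eq_mul (χ : IrrChar G) :
    χ.sigma = χ.schurIndex * finrank ℚ χ.field * χ.deg := by
  obtain ⟨W, _, _, _, τ, h1, h2⟩ := χ.exists_irreducible_mult
  rw [χ.sigma_eq h1 h2, χ.finrank_eq h1 h2]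

theorem IrrChar.schurIndex_pos (χ : IrrChar G) : 0 < χ.schurIndex := by
  obtain ⟨W, _, _, _, τ, h1, h2⟩ := χ.exists_irreducible_mult
  rw [← χ.mult_self h1 h2]
  exact Nat.pos_of_ne_zero h2

theorem IrrChar.sigma_pos (χ : IrrChar G) : 0 < χ.sigma := by
  obtain ⟨W, _, _, _, τ, h1, h2⟩ := χ.exists_irreducible_mult
  rw [χ.sigma_eq h1 h2]
  have := nontrivial_of_isIrreducible _ h1
  exact finrank_pos

/-- The Schur index and `σ` are constant on Galois orbits. -/
theorem IrrChar.sigma_congr {χ χ' : IrrChar G} (h : (IrrChar.galoisSetoid G).r χ χ') :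
    χ.schurIndex = χ'.schurIndex ∧ χ.sigma = χ'.sigma := by
  classical
  obtain ⟨W, _, _, _, τ, h1, h2⟩ := χ.exists_irreducible_mult
  have h3 := χ.mult_eq h1 h2 χ'
  rw [if_pos h] at h3
  have h4 : χ'.mult τ ≠ 0 := by rw [h3]; exact χ.schurIndex_pos.ne'
  rw [← h3, χ'.mult_self h1 h4, χ.sigma_eq h1 h2, χ'.sigma_eq h1 h4]
  exact ⟨rfl, rfl⟩

end Rational

/-! ### The rational span -/

section Span

variable {G : Type*} [Group G]

theorem sigma_congr {V V' : Type*} [AddCommGroup V] [Module ℂ V] [AddCommGroup V'] [Module ℂ V']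
    {ρ : Representation ℂ G V} {ρ' : Representation ℂ G V'} (e : Representation.Equiv ρ ρ') :
    sigma ρ = sigma ρ' := by
  refine congrArg sInf (Set.ext fun d => ⟨?_, ?_⟩)
  · rintro ⟨W, _, _, i, τ, f, hf, hd⟩
    exact ⟨W, _, _, i, τ, f.comp e.symm.toIntertwiningMap,
      hf.comp e.symm.toLinearEquiv.injective, hd⟩
  · rintro ⟨W, _, _, i, τ, f, hf, hd⟩
    exact ⟨W, _, _, i, τ, f.comp e.toIntertwiningMap, hf.comp e.toLinearEquiv.injective, hd⟩

theorem schurIndex_congr {V V' : Type*} [AddCommGroup V] [Module ℂ V] [AddCommGroup V']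
    [Module ℂ V'] {ρ : Representation ℂ G V} {ρ' : Representation ℂ G V'}
    (e : Representation.Equiv ρ ρ') : schurIndex ρ = schurIndex ρ' := by
  have h : ∀ (L : Type) [Field L] [Algebra L ℂ], RealizableOver L ρ ↔ RealizableOver L ρ' := by
    intro L _ _
    constructor
    · rintro ⟨W, _, _, i, τ, ⟨e'⟩⟩
      exact ⟨W, _, _, i, τ, ⟨e'.trans e⟩⟩
    · rintro ⟨W, _, _, i, τ, ⟨e'⟩⟩
      exact ⟨W, _, _, i, τ, ⟨e'.trans e.symm⟩⟩
  unfold schurIndex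
  simp only [h]
  rw [char_iso e]

variable [Finite G]

/-- The orbit of an irreducible character. -/
def IrrChar.orb (χ : IrrChar G) : Orb G := Quotient.mk (IrrChar.galoisSetoid G) χ

theorem IrrChar.orb_eq_iff {χ χ' : IrrChar G} :
    χ.orb = χ'.orb ↔ (IrrChar.galoisSetoid G).r χ χ' :=
  ⟨fun h => Quotient.exact h, fun h => Quotient.sound (s := IrrChar.galoisSetoid G) h⟩

theorem Orb.mem_chars {Γ : Orb G} {χ : IrrChar G} :
    χ ∈ Γ.chars ↔ χ.orb = Γ := by
  classical
  rw [Orb.chars, Finset.mem_filter]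
  exact ⟨fun h => h.2, fun h => ⟨Finset.mem_univ _, h⟩⟩

/-- The common value of `σ` on an orbit. -/
noncomputable def Orb.sigma (Γ : Orb G) : ℕ := (Quotient.out Γ : IrrChar G).sigma

theorem Orb.sigma_mk (χ : IrrChar G) :
    Orb.sigma χ.orb = χ.sigma :=
  (IrrChar.sigma_congr (IrrChar.orb_eq_iff.1 (Quotient.out_eq χ.orb))).2

/-- The multiplicities in a rational module are determined by one number `k Γ` for each Galois
orbit `Γ`: the number of its irreducible constituents that contain the characters in `Γ`. -/
theorem exists_orbit_multiplicities {W : Type} [AddCommGroup W] [Module ℚ W]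
    [FiniteDimensional ℚ W] (τ : Representation ℚ G W) :
    ∃ k : Orb G → ℕ, (∀ χ : IrrChar G,
      χ.mult τ = k χ.orb * χ.schurIndex) ∧
      finrank ℚ W = ∑ Γ, k Γ * Γ.sigma := by
  classical
  induction hd : finrank ℚ W using Nat.strong_induction_on generalizing W with
  | _ d ih =>
  subst hd
  rcases subsingleton_or_nontrivial W with hW | hW
  · refine ⟨0, fun χ => ?_, ?_⟩
    · by_contra h
      rw [Pi.zero_apply, zero_mul] at h
      obtain ⟨f, hf⟩ := χ.exists_injective h
      have := nontrivial_of_isIrreducible _ χ.rep_irreducible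
      exact not_subsingleton _ (hf.subsingleton (α := Fin χ.deg → ℂ))
    · simp [finrank_zero_of_subsingleton]
  obtain ⟨p, q, hp, ⟨e⟩⟩ := exists_irreducible_prod τ
  have h2 := e.toLinearEquiv.finrank_eq
  rw [finrank_prod] at h2
  have := nontrivial_of_isIrreducible _ hp
  have hpos := finrank_pos (R := ℚ) (M := p.toSubmodule)
  obtain ⟨k, hk, hdim⟩ := ih _ (by omega) q.toRepresentation rfl
  -- Some `χ₀` occurs in `p`: otherwise `ℂ ⊗ p` would embed into the zero module.
  obtain ⟨χ₀, h0⟩ : ∃ χ : IrrChar G, χ.mult p.toRepresentation ≠ 0 := by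
    by_contra! h0
    obtain ⟨f, hf⟩ := exists_injective_of_finrank_hom_le (extendScalars ℂ p.toRepresentation)
      (trivial ℂ G PUnit) fun χ => (h0 χ).trans_le (Nat.zero_le _)
    have := hf.subsingleton
    exact not_subsingleton (ℂ ⊗[ℚ] p.toSubmodule) this
  let Γ₀ : Orb G := χ₀.orb
  refine ⟨k + Pi.single Γ₀ 1, fun χ => ?_, ?_⟩
  · rw [← χ.mult_congr (char_iso e), χ.mult_prod, hk, χ₀.mult_eq hp h0, Pi.add_apply, add_mul,
      add_comm, Pi.single_apply]
    congr 1
    by_cases h : (IrrChar.galoisSetoid G).r χ₀ χ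
    · rw [if_pos h, if_pos (IrrChar.orb_eq_iff.2 h).symm, one_mul, (IrrChar.sigma_congr h).1]
    · rw [if_neg h, if_neg fun h' => h (IrrChar.orb_eq_iff.1 h'.symm), zero_mul]
  · rw [← h2, hdim, ← χ₀.sigma_eq hp h0, ← Orb.sigma_mk]
    simp only [Pi.add_apply, add_mul, Finset.sum_add_distrib]
    rw [add_comm]
    congr 1
    rw [Finset.sum_eq_single Γ₀ (fun Γ _ h => by rw [Pi.single_eq_of_ne h, zero_mul])
      fun h => absurd (Finset.mem_univ _) h, Pi.single_eq_same, one_mul]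

/-- Every family `k` arises from a rational module, a direct sum of irreducible ones. -/
theorem exists_rational_of_multiplicities (k : Orb G → ℕ) :
    ∃ (W : Type) (_ : AddCommGroup W) (_ : Module ℚ W) (_ : FiniteDimensional ℚ W)
      (τ : Representation ℚ G W), (∀ χ : IrrChar G,
        χ.mult τ = k χ.orb * χ.schurIndex) ∧
      finrank ℚ W = ∑ Γ, k Γ * Γ.sigma := by
  classical
  induction hs : ∑ Γ, k Γ generalizing k with
  | zero =>
    have hk : k = 0 := funext fun Γ => Finset.sum_eq_zero_iff.1 hs Γ (Finset.mem_univ _)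
    subst hk
    -- The zero module has multiplicities zero.
    obtain ⟨k, hk, hdim⟩ := exists_orbit_multiplicities (trivial ℚ G PUnit)
    have h : ∀ Γ, k Γ * Γ.sigma = 0 := fun Γ =>
      Finset.sum_eq_zero_iff.1 (hdim.symm.trans finrank_zero_of_subsingleton) Γ (Finset.mem_univ _)
    refine ⟨PUnit, _, _, inferInstance, trivial ℚ G PUnit, fun χ => ?_, ?_⟩
    · have := h χ.orb
      rw [Orb.sigma_mk] at this
      rw [hk, (mul_eq_zero.1 this).resolve_right χ.sigma_pos.ne']
      rfl
    · simp [finrank_zero_of_subsingleton]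
  | succ N ih =>
    obtain ⟨Γ₀, hΓ⟩ : ∃ Γ, k Γ ≠ 0 := by
      by_contra! h
      simp [h] at hs
    obtain ⟨k', rfl⟩ : ∃ k', k = k' + Pi.single Γ₀ 1 := by
      refine ⟨k - Pi.single Γ₀ 1, (tsub_add_cancel_of_le fun Γ => ?_).symm⟩
      rw [Pi.single_apply]
      split_ifs with h
      · rw [h]; exact Nat.pos_of_ne_zero hΓ
      · exact Nat.zero_le _
    have hs' : ∑ Γ, k' Γ = N := by
      simp only [Pi.add_apply, Finset.sum_add_distrib, Finset.sum_pi_single',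
        Finset.mem_univ, if_true] at hs
      omega
    obtain ⟨W, _, _, _, τ, hk, hdim⟩ := ih k' hs'
    obtain ⟨χ₀, rfl⟩ : ∃ χ₀ : IrrChar G, χ₀.orb = Γ₀ := Quotient.exists_rep Γ₀
    obtain ⟨W', _, _, _, τ', h1, h2⟩ := χ₀.exists_irreducible_mult
    refine ⟨W × W', _, _, inferInstance, τ.prod τ', fun χ => ?_, ?_⟩
    · rw [χ.mult_prod, hk, χ₀.mult_eq h1 h2, Pi.add_apply, add_mul, Pi.single_apply]
      congr 1
      by_cases h : (IrrChar.galoisSetoid G).r χ₀ χ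
      · rw [if_pos h, if_pos (IrrChar.orb_eq_iff.2 h).symm, one_mul, (IrrChar.sigma_congr h).1]
      · rw [if_neg h, if_neg fun h' => h (IrrChar.orb_eq_iff.1 h'.symm), zero_mul]
    · rw [finrank_prod, hdim, ← χ₀.sigma_eq h1 h2, ← Orb.sigma_mk]
      simp only [Pi.add_apply, add_mul, Finset.sum_add_distrib]
      congr 1
      rw [Finset.sum_eq_single (IrrChar.orb χ₀)
        (fun Γ _ h => by rw [Pi.single_eq_of_ne h, zero_mul])
        fun h => absurd (Finset.mem_univ _) h, Pi.single_eq_same, one_mul]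

theorem Phi_eq {V : Type*} [AddCommGroup V] [Module ℂ V] [FiniteDimensional ℂ V]
    {ρ : Representation ℂ G V} (hρ : ρ.IsIrreducible) :
    Phi ρ = (schurIndex ρ : ℚ) * (finrank ℚ (charField ρ.character) : ℚ) := by
  obtain ⟨χ, hχ⟩ := exists_irrChar hρ
  obtain ⟨e⟩ := IrrChar.nonempty_equiv hρ hχ
  have := nontrivial_of_isIrreducible _ hρ
  have hpos : (finrank ℂ V : ℚ) ≠ 0 := Nat.cast_ne_zero.2 finrank_pos.ne'
  have h1 : sigma ρ = schurIndex ρ * finrank ℚ (charField ρ.character) * finrank ℂ V := by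
    rw [← sigma_congr e, ← schurIndex_congr e, ← char_iso e, ← e.toLinearEquiv.finrank_eq,
      finrank_fin_fun]
    exact χ.sigma_eq_mul
  rw [Phi, h1, Nat.cast_mul, Nat.cast_mul, mul_div_cancel_right₀ _ hpos]

/-- The rational span of a module: the family `k` of orbit multiplicities of a rational module
containing it must satisfy `n χ ≤ k Γ * m(χ)` for `χ ∈ Γ`, and this is sufficient. -/
theorem sigma_eq_sum {V : Type*} [AddCommGroup V] [Module ℂ V] [FiniteDimensional ℂ V]
    {ρ : Representation ℂ G V} (n : IrrChar G → ℕ) (h : ρ.character = ∑ χ, n χ • χ.1) :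
    sigma ρ = ∑ Γ : Orb G, Γ.chars.sup' Γ.chars_nonempty
      (fun χ => ⌈(n χ : ℚ) / (χ.schurIndex : ℚ)⌉₊ * χ.sigma) := by
  classical
  have hn : ∀ χ : IrrChar G, finrank ℂ (IntertwiningMap χ.rep ρ) = n χ := fun χ => by
    rw [χ.finrank_hom_sum Finset.univ n (fun χ => χ) h]
    simp
  have hceil : ∀ (χ : IrrChar G) (k : ℕ), ⌈(n χ : ℚ) / (χ.schurIndex : ℚ)⌉₊ ≤ k ↔
      n χ ≤ k * χ.schurIndex := fun χ k => by
    rw [Nat.ceil_le, div_le_iff₀ (Nat.cast_pos.2 χ.schurIndex_pos)]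
    exact_mod_cast Iff.rfl
  apply le_antisymm
  -- For the upper bound, the maximum over `Γ` is attained at `c Γ`, and `k Γ` is taken to be the
  -- ceiling at `c Γ`; since `σ` is constant on `Γ`, it bounds the ceilings at the other characters.
  · choose c hc hmax using fun Γ : Orb G => Finset.exists_mem_eq_sup' Γ.chars_nonempty
      (fun χ => ⌈(n χ : ℚ) / (χ.schurIndex : ℚ)⌉₊ * χ.sigma)
    obtain ⟨W, _, _, _, τ, hk, hdim⟩ := exists_rational_of_multiplicities fun Γ : Orb G =>
      ⌈(n (c Γ) : ℚ) / ((c Γ).schurIndex : ℚ)⌉₊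
    have hs : ∀ {Γ : Orb G} {χ : IrrChar G}, χ ∈ Γ.chars → Γ.sigma = χ.sigma := by
      intro Γ χ hχ
      rw [← Orb.mem_chars.1 hχ, Orb.sigma_mk]
    obtain ⟨f, hf⟩ := exists_injective_of_finrank_hom_le ρ (extendScalars ℂ τ) fun χ => by
      change _ ≤ χ.mult τ
      rw [hn, hk, ← hceil]
      have hχ : χ ∈ Orb.chars χ.orb :=
        Orb.mem_chars.2 rfl
      have h1 := Finset.le_sup' (fun χ => ⌈(n χ : ℚ) / (χ.schurIndex : ℚ)⌉₊ * χ.sigma) hχ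
      rw [hmax, ← hs hχ, ← hs (hc _)] at h1
      refine Nat.le_of_mul_le_mul_right h1 ?_
      rw [hs hχ]
      exact χ.sigma_pos
    refine Nat.sInf_le ⟨W, _, _, ‹_›, τ, f, hf, ?_⟩
    rw [hdim]
    refine Finset.sum_congr rfl fun Γ _ => ?_
    rw [hmax, hs (hc Γ)]
  -- For the lower bound, a rational module of least dimension is used; one has to exist, since
  -- the infimum of the empty set is `0`.
  · have hne : (spanDims ρ).Nonempty := by
      obtain ⟨W, _, _, _, τ, hk, hdim⟩ := exists_rational_of_multiplicities fun _ : Orb G =>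
        ∑ χ, n χ
      obtain ⟨f, hf⟩ := exists_injective_of_finrank_hom_le ρ (extendScalars ℂ τ) fun χ => by
        change _ ≤ χ.mult τ
        rw [hn, hk]
        exact (Finset.single_le_sum (fun _ _ => Nat.zero_le _) (Finset.mem_univ χ)).trans
          (Nat.le_mul_of_pos_right _ χ.schurIndex_pos)
      exact ⟨_, W, _, _, ‹_›, τ, f, hf, rfl⟩
    obtain ⟨W, _, _, _, τ, f, hf, hd⟩ := Nat.sInf_mem hne
    rw [sigma, ← hd]
    obtain ⟨k, hk, hdim⟩ := exists_orbit_multiplicities τ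
    rw [hdim]
    refine Finset.sum_le_sum fun Γ _ => Finset.sup'_le _ _ fun χ hχ => ?_
    have hΓ := Orb.mem_chars.1 hχ
    subst hΓ
    rw [Orb.sigma_mk]
    refine Nat.mul_le_mul_right _ ((hceil _ _).2 ?_)
    rw [← hn, ← hk]
    exact finrank_hom_le_of_injective f hf χ.rep

end Span

end RatSpan

theorem lemma4p1 {G : Type*} [Group G] [Finite G] :
    -- (a) irreducible modules
    (∀ {V : Type*} [AddCommGroup V] [Module ℂ V] [FiniteDimensional ℂ V]
      (ρ : Representation ℂ G V), ρ.IsIrreducible →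
        RatSpan.Phi ρ = (RatSpan.schurIndex ρ : ℚ) *
          (Module.finrank ℚ (RatSpan.charField ρ.character) : ℚ) ∧
        ∃ k : ℤ, RatSpan.Phi ρ = (k : ℚ)) ∧
    -- (b) arbitrary modules
    (∀ {V : Type*} [AddCommGroup V] [Module ℂ V] [FiniteDimensional ℂ V]
      (ρ : Representation ℂ G V) (n : RatSpan.IrrChar G → ℕ),
        ρ.character = ∑ χ, n χ • χ.1 →
        RatSpan.sigma ρ = ∑ Γ : RatSpan.Orb G, Γ.chars.sup' Γ.chars_nonempty
          (fun χ => ⌈(n χ : ℚ) / (χ.schurIndex : ℚ)⌉₊ * χ.sigma)) := by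
  refine ⟨fun ρ hρ => ⟨RatSpan.Phi_eq hρ, ?_⟩, fun ρ n h => RatSpan.sigma_eq_sum n h⟩
  refine ⟨(RatSpan.schurIndex ρ * Module.finrank ℚ (RatSpan.charField ρ.character) : ℕ), ?_⟩
  rw [RatSpan.Phi_eq hρ]
  push_cast
  rfl
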